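/- Let $A$ be an associative unital ring, let $M$ be a left $A$-module that is generated by a countable set, and let $R=\operatorname{Hom}_A(M,M)^{\mathrm{op}}$ be its endomorphism ring, acting on $M$ on the right. Call a module coperfect if every descending chain of cyclic submodules of it terminates. Assume that $M$ is $\Sigma$-coperfect over $R$, that is, the direct sum $M^{(\omega)}=\bigoplus_{n=0}^{\infty}M$ is a coperfect right $R$-module. Then $M$ has a perfect decomposition: there is a family $(M_z)_{z\in Z}$ of nonzero left $A$-modules such that $M\cong\bigoplus_{z\in Z}M_z$ and the family is locally T-nilpotent, i.e. for every sequence of indices $z_1,z_2,z_3,\dots\in Z$ (repetitions allowed) and every sequence of $A$-module homomorphisms $f_i\colon M_{z_i}\to M_{z_{i+1}}$ none of which is an isomorphism, the family of composites $f_nf_{n-1}\cdots f_1\colon M_{z_1}\to M_{z_{n+1}}$, $n\ge 1$, is summable: there is an $A$-module homomorphism $M_{z_1}\to\bigoplus_{n=1}^{\infty}M_{z_{n+1}}$ whose $n$-th component is $f_n\cdots f_1$ for every $n\ge1$ (equivalently, for every $x\in M_{z_1}$ one has $f_nf_{n-1}\cdots f_1(x)=0$ for all large $n$). -/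

import Mathlib

open scoped DirectSum

universe u v w

namespace PerfectDecomp

/-- A module is countably generated if it is spanned by a countable (possibly finite) set. -/
def IsCountablyGenerated (A : Type u) [Ring A] (M : Type v) [AddCommGroup M] [Module A M] : Prop :=
  ∃ s : Set M, s.Countable ∧ Submodule.span A s = ⊤

/-- An `S`-module `N` is coperfect if every descending chain of cyclic `S`-submodules
of `N` terminates. -/
def IsCoperfect (S : Type u) [Ring S] (N : Type v) [AddCommGroup N] [Module S N] : Prop :=
  ∀ x : ℕ → N, (∀ n, Submodule.span S {x (n + 1)} ≤ Submodule.span S {x n}) →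
    ∃ n, ∀ m, n ≤ m → Submodule.span S {x m} = Submodule.span S {x n}

/-- An `S`-module `N` is `Σ`-coperfect if the direct sum of countably many copies of `N`
is a coperfect `S`-module. -/
def IsSigmaCoperfect (S : Type u) [Ring S] (N : Type v) [AddCommGroup N] [Module S N] : Prop :=
  IsCoperfect S (⨁ _ : ℕ, N)

/-- A left `A`-module `M` is endo-`Σ`-coperfect if it is `Σ`-coperfect over its endomorphism ring.
`Module.End A M` acts on `M` on the left by evaluation, which is the same thing as the right action
of the opposite ring `Hom_A(M, M)ᵒᵖ`; the action on the direct sum is componentwise. -/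
def IsEndoSigmaCoperfect (A : Type u) [Ring A] (M : Type v) [AddCommGroup M] [Module A M] : Prop :=
  IsSigmaCoperfect (Module.End A M) M

/-- A family of linear maps `f i : M → N i` is summable if it corresponds to a linear map
from `M` to the direct sum of the `N i`. -/
def IsSummableFamily {A : Type u} [Ring A] {M : Type v} [AddCommGroup M] [Module A M]
    {ι : Type w} {N : ι → Type v} [∀ i, AddCommGroup (N i)] [∀ i, Module A (N i)]
    (f : ∀ i, M →ₗ[A] N i) : Prop :=
  ∃ g : M →ₗ[A] ⨁ i, N i, ∀ (i : ι) (x : M), g x i = f i x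

/-- For `N 0 → N 1 → N 2 → ⋯` the composite `f n ∘ ⋯ ∘ f 1 ∘ f 0 : N 0 → N (n + 1)`. -/
def seqComp {A : Type u} [Ring A] {N : ℕ → Type v} [∀ n, AddCommGroup (N n)]
    [∀ n, Module A (N n)] (f : ∀ n, N n →ₗ[A] N (n + 1)) : ∀ n, N 0 →ₗ[A] N (n + 1)
  | 0 => f 0
  | n + 1 => f (n + 1) ∘ₗ seqComp f n

/-- A family of nonzero modules is locally T-nilpotent if for every sequence of indices
(repetitions allowed) and every sequence of nonisomorphisms between the corresponding modules,
the family of composites starting at the first module is summable. -/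
def IsLocallyTNilpotent (A : Type u) [Ring A] {Z : Type w} (N : Z → Type v)
    [∀ z, AddCommGroup (N z)] [∀ z, Module A (N z)] : Prop :=
  (∀ z, Nontrivial (N z)) ∧
    ∀ (z : ℕ → Z) (f : ∀ i, N (z i) →ₗ[A] N (z (i + 1))),
      (∀ i, ¬ Function.Bijective (f i)) →
        IsSummableFamily (N := fun n => N (z (n + 1))) (seqComp (N := fun n => N (z n)) f)

/-- A module has a perfect decomposition if it is isomorphic to the direct sum of a locally
T-nilpotent family of modules. -/
def HasPerfectDecomposition (A : Type u) [Ring A] (M : Type v) [AddCommGroup M] [Module A M] :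
    Prop :=
  ∃ (Z : Type v) (N : Z → Type v) (_ : ∀ z, AddCommGroup (N z)) (_ : ∀ z, Module A (N z)),
    IsLocallyTNilpotent A N ∧ Nonempty (M ≃ₗ[A] ⨁ z, N z)

end PerfectDecomp

/-! Σ-coperfectness enters only as `HasStableOrbits`: along any sequence of endomorphisms, some step
is reversible on a given finite set. This passes to direct summands, as does countable generation.
Inside a suitable monoid of endomorphisms it gives minimal orbits on finite sets, and countable
generation lets a diagonal argument (`exists_isMinimalOn`) produce one element minimal on all finite
sets at once.

For the monoid of maps congruent to 1 modulo a locally split `P`, the minimal element is an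
idempotent with kernel `P`. So locally split submodules, in particular directed unions of summands,
are summands. By Zorn, every nonzero summand then has an indecomposable summand. For the monoid of
maps fixing a well-chosen vector, the minimal element shows that an indecomposable summand has local
endomorphism ring. A second use of Zorn splits `M` into such summands, and reversibility of a step,
combined with locality, forces T-nilpotence. -/

namespace PerfectDecomp

/-! ### Reversible steps from coperfectness -/

section StableOrbits

variable {A : Type u} [Ring A] {M : Type v} [AddCommGroup M] [Module A M]
  {N : Type v} [AddCommGroup N] [Module A N]

/-- The composite `s (n - 1) * ⋯ * s 1 * s 0` of the first `n` terms of a sequence. -/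
def partialComp (s : ℕ → Module.End A N) : ℕ → Module.End A N
  | 0 => 1
  | n + 1 => s n * partialComp s n

theorem partialComp_const (s : Module.End A N) (n : ℕ) : partialComp (fun _ => s) n = s ^ n := by
  induction n with
  | zero => rfl
  | succ n ih => rw [partialComp, ih, pow_succ']

variable (A N) in
/-- For every finite subset `F` and every sequence of endomorphisms, some step of the sequence of
partial composites can be undone on `F` by an endomorphism. -/
def HasStableOrbits : Prop :=
  ∀ (F : Finset N) (s : ℕ → Module.End A N), ∃ (n : ℕ) (t : Module.End A N),
    ∀ x ∈ F, t (s n (partialComp s n x)) = partialComp s n x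

/-- A finite set is one vector of the direct sum, and the partial composites applied to it generate
a descending chain of cyclic submodules. -/
theorem IsEndoSigmaCoperfect.hasStableOrbits (h : IsEndoSigmaCoperfect A N) :
    HasStableOrbits A N := by
  classical
  intro F s
  let ξ : ⨁ _ : ℕ, N := DirectSum.mk (fun _ : ℕ => N) (Finset.range F.toList.length)
    (fun i => F.toList.getD i 0)
  have hξ : ∀ x ∈ F, ∃ i, ξ i = x := by
    intro x hx
    obtain ⟨i, hi, rfl⟩ := List.getElem_of_mem (Finset.mem_toList.2 hx)
    refine ⟨i, ?_⟩
    have := DirectSum.mk_apply_of_mem (β := fun _ : ℕ => N)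
      (f := fun i => F.toList.getD i 0) (Finset.mem_range.2 hi)
    refine this.trans ?_
    exact (List.getD_eq_getElem _ _ hi)
  obtain ⟨n, hn⟩ := h (fun n => partialComp s n • ξ) (fun n => by
    rw [Submodule.span_singleton_le_iff_mem, Submodule.mem_span_singleton]
    exact ⟨s n, by simp only [partialComp, mul_smul]⟩)
  have hmem : partialComp s n • ξ ∈ Submodule.span (Module.End A N) {partialComp s (n + 1) • ξ} := by
    rw [hn (n + 1) n.le_succ]
    exact Submodule.mem_span_singleton_self _
  obtain ⟨t, ht⟩ := Submodule.mem_span_singleton.1 hmem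
  refine ⟨n, t, fun x hx => ?_⟩
  obtain ⟨i, rfl⟩ := hξ x hx
  have := congrArg (fun η : ⨁ _ : ℕ, N => η i) ht
  simpa [DirectSum.smul_apply, partialComp] using this

theorem HasStableOrbits.of_retract (h : HasStableOrbits A M) (i : N →ₗ[A] M) (π : M →ₗ[A] N)
    (hπ : ∀ x, π (i x) = x) : HasStableOrbits A N := by
  classical
  intro F s
  obtain ⟨n, t, ht⟩ := h (F.image i) (fun n => i ∘ₗ s n ∘ₗ π)
  have key : ∀ n x, partialComp (fun n => i ∘ₗ s n ∘ₗ π) n (i x) = i (partialComp s n x) := by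
    intro n x
    induction n with
    | zero => rfl
    | succ n ih => simp [partialComp, ih, hπ]
  refine ⟨n, π ∘ₗ t ∘ₗ i, fun x hx => ?_⟩
  have := ht (i x) (Finset.mem_image_of_mem i hx)
  rw [key] at this
  simpa [hπ] using congrArg π this

theorem IsCountablyGenerated.of_surjective (h : IsCountablyGenerated A M) (π : M →ₗ[A] N)
    (hπ : Function.Surjective π) : IsCountablyGenerated A N := by
  obtain ⟨s, hs, hspan⟩ := h
  exact ⟨π '' s, hs.image π, by
    rw [Submodule.span_image, hspan, Submodule.map_top, LinearMap.range_eq_top.2 hπ]⟩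

/-- Otherwise, repeatedly choosing an irreversible step in `K` gives a sequence violating stability.
The inverse `t` need not lie in `K`; each application must arrange that. -/
theorem HasStableOrbits.exists_forall_exists (h : HasStableOrbits A N)
    (K : Submonoid (Module.End A N)) (F : Finset N) (q : Module.End A N) :
    ∃ p ∈ K, ∀ p' ∈ K, ∃ t : Module.End A N, ∀ x ∈ F, t (p' ((p * q) x)) = (p * q) x := by
  classical
  by_contra! hcon
  choose! f hfK hf using hcon
  let g : ℕ → Module.End A N := fun n => Nat.rec 1 (fun _ p => f p * p) n
  have hg : ∀ n, g n ∈ K := by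
    intro n
    induction n with
    | zero => exact K.one_mem
    | succ n ih => exact K.mul_mem (hfK _ ih) ih
  have hcomp : ∀ n, partialComp (fun n => f (g n)) n = g n := by
    intro n
    induction n with
    | zero => rfl
    | succ n ih => rw [partialComp, ih]
  obtain ⟨n, t, ht⟩ := h (F.image q) (fun n => f (g n))
  obtain ⟨x, hx, hne⟩ := hf (g n) (hg n) t
  apply hne
  have := ht (q x) (Finset.mem_image_of_mem q hx)
  rwa [hcomp] at this

theorem HasStableOrbits.exists_minimal_orbit (h : HasStableOrbits A N) [Nontrivial N] :
    ∃ y : N, y ≠ 0 ∧ ∀ s : Module.End A N, s y ≠ 0 → ∃ t : Module.End A N, t (s y) = y := by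
  by_contra! hcon
  choose! f hf0 hf using hcon
  obtain ⟨y, hy⟩ := exists_ne (0 : N)
  let g : ℕ → N := fun n => Nat.rec y (fun _ z => f z z) n
  have hg : ∀ n, g n ≠ 0 := by
    intro n
    induction n with
    | zero => exact hy
    | succ n ih => exact hf0 _ ih
  have hcomp : ∀ n, partialComp (fun n => f (g n)) n y = g n := by
    intro n
    induction n with
    | zero => rfl
    | succ n ih => rw [partialComp, Module.End.mul_apply, ih]
  obtain ⟨n, t, ht⟩ := h {y} (fun n => f (g n))
  have := ht y (Finset.mem_singleton_self y)
  rw [hcomp] at this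
  exact hf (g n) (hg n) t this

end StableOrbits

/-! ### Gluing minimal elements over a countable generating set -/

section Limits

variable {A : Type u} [Ring A] {N : Type v} [AddCommGroup N] [Module A N]

theorem IsCountablyGenerated.exists_finset_monotone_span (h : IsCountablyGenerated A N) :
    ∃ F : ℕ → Finset N, Monotone (fun k => Submodule.span A (F k : Set N)) ∧
      ∀ G : Finset N, ∃ k, (G : Set N) ⊆ Submodule.span A (F k : Set N) := by
  classical
  obtain ⟨s, hs, hspan⟩ := h
  obtain ⟨x, hx⟩ := (hs.insert 0).exists_eq_range (Set.insert_nonempty 0 s)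
  have hmono : Monotone (fun k => Submodule.span A
      (((Finset.range k).image x : Finset N) : Set N)) := fun i j hij =>
    Submodule.span_mono (Finset.coe_subset.2 (Finset.image_subset_image (Finset.range_mono hij)))
  have htop : ⨆ k, Submodule.span A (((Finset.range k).image x : Finset N) : Set N) = ⊤ := by
    rw [eq_top_iff, ← hspan, Submodule.span_le]
    intro y hy
    obtain ⟨k, rfl⟩ : y ∈ Set.range x := hx ▸ Set.mem_insert_of_mem 0 hy
    exact Submodule.mem_iSup_of_mem (k + 1)
      (Submodule.subset_span (Finset.mem_coe.2 (Finset.mem_image_of_mem x (by simp))))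
  refine ⟨fun k => (Finset.range k).image x, hmono, fun G => ?_⟩
  induction G using Finset.induction_on with
  | empty => exact ⟨0, by simp⟩
  | insert a G ha ih =>
    obtain ⟨k, hk⟩ := ih
    have ha : a ∈ ⨆ k, Submodule.span A (((Finset.range k).image x : Finset N) : Set N) :=
      htop ▸ Submodule.mem_top
    obtain ⟨j, hj⟩ := (Submodule.mem_iSup_of_directed _ hmono.directed_le).1 ha
    refine ⟨max j k, ?_⟩
    rw [Finset.coe_insert, Set.insert_subset_iff]
    exact ⟨hmono (le_max_left j k) hj, hk.trans (hmono (le_max_right j k))⟩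

theorem exists_linearMap_eq_on {S : ℕ → Submodule A N} (hS : Monotone S)
    (htop : ∀ x, ∃ k, x ∈ S k) (U : ℕ → Module.End A N)
    (hU : ∀ k, ∀ x ∈ S k, U (k + 1) x = U k x) :
    ∃ u : Module.End A N, ∀ k, ∀ x ∈ S k, u x = U k x := by
  have hle : ∀ k m, k ≤ m → ∀ x ∈ S k, U m x = U k x := by
    intro k m hkm x hx
    induction m, hkm using Nat.le_induction with
    | base => rfl
    | succ m hkm ih => rw [hU m x (hS hkm hx), ih]
  choose κ hκ using htop
  have heq : ∀ k, ∀ x ∈ S k, U (κ x) x = U k x := by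
    intro k x hx
    rw [← hle _ _ (le_max_left k (κ x)) x hx, ← hle _ _ (le_max_right k (κ x)) x (hκ x)]
  refine ⟨{ toFun := fun x => U (κ x) x, map_add' := fun x y => ?_, map_smul' := fun a x => ?_ },
    heq⟩
  · have hx := hS (le_max_left (κ x) (κ y)) (hκ x)
    have hy := hS (le_max_right (κ x) (κ y)) (hκ y)
    rw [heq _ _ hx, heq _ _ hy, heq _ _ (add_mem hx hy), map_add]
  · rw [heq (κ x) _ ((S (κ x)).smul_mem a (hκ x)), map_smul, RingHom.id_apply]

/-- The element `q` generates a minimal `K`-orbit on the finite set `F`. -/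
def IsMinimalOn (K : Submonoid (Module.End A N)) (F : Finset N) (q : Module.End A N) : Prop :=
  ∀ p ∈ K, ∃ t ∈ K, ∀ x ∈ F, t (p (q x)) = q x

theorem eqOn_span {F : Set N} {f g : Module.End A N} (h : ∀ x ∈ F, f x = g x) :
    ∀ x ∈ Submodule.span A F, f x = g x :=
  fun _ hx => LinearMap.eqOn_span (s := F) h hx

/-- A submonoid closed in the finite topology in which minimal orbits exist on all finite sets
has an element generating minimal orbits on all finite sets simultaneously. -/
theorem exists_isMinimalOn (hN : IsCountablyGenerated A N) (K : Submonoid (Module.End A N))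
    (hK : ∀ u : Module.End A N, (∀ F : Finset N, ∃ q ∈ K, ∀ x ∈ F, u x = q x) → u ∈ K)
    (hmin : ∀ (F : Finset N), ∀ q ∈ K, ∃ p ∈ K, IsMinimalOn K F (p * q)) :
    ∃ u ∈ K, ∀ F, IsMinimalOn K F u := by
  obtain ⟨F, hmono, hF⟩ := hN.exists_finset_monotone_span
  -- The approximation is `w * q` with `q` minimal on `F k`. Replacing `q` by `p * q` is compensated
  -- by a `t` undoing `p` on `F k`, so `(w * t) * (p * q)` keeps the old values there.
  let T : ℕ → Module.End A N → Prop := fun k u =>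
    ∃ q ∈ K, ∃ w ∈ K, u = w * q ∧ IsMinimalOn K (F k) q
  have hT0 : ∃ u, T 0 u := by
    obtain ⟨p, hp, h⟩ := hmin (F 0) 1 K.one_mem
    exact ⟨1 * (p * 1), p * 1, K.mul_mem hp K.one_mem, 1, K.one_mem, rfl, h⟩
  have hstep : ∀ k (u : {u // T k u}), ∃ u' : {u // T (k + 1) u}, ∀ x ∈ F k, u'.1 x = u.1 x := by
    rintro k ⟨_, q, hq, w, hw, rfl, h⟩
    obtain ⟨p, hp, h'⟩ := hmin (F (k + 1)) q hq
    obtain ⟨t, ht, htx⟩ := h p hp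
    refine ⟨⟨(w * t) * (p * q), p * q, K.mul_mem hp hq, w * t, K.mul_mem hw ht, rfl, h'⟩, ?_⟩
    intro x hx
    simp [htx x hx]
  choose next hnext using hstep
  let U : ∀ k, {u // T k u} := fun k => Nat.rec ⟨_, hT0.choose_spec⟩ next k
  obtain ⟨u, hu⟩ := exists_linearMap_eq_on (S := fun k => Submodule.span A (F k : Set N)) hmono
    (fun x => by
      obtain ⟨k, hk⟩ := hF {x}
      exact ⟨k, hk (by simp)⟩) (fun k => (U k).1)
    (fun k => eqOn_span (hnext k (U k)))
  refine ⟨u, hK u fun G => ?_, fun G p hp => ?_⟩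
  · obtain ⟨k, hk⟩ := hF G
    obtain ⟨q, hq, w, hw, h, -⟩ := (U k).2
    exact ⟨(U k).1, h ▸ K.mul_mem hw hq, fun x hx => hu k x (hk hx)⟩
  · obtain ⟨k, hk⟩ := hF G
    obtain ⟨q, hq, w, hw, h, hqmin⟩ := (U k).2
    obtain ⟨t, ht, htx⟩ := hqmin (p * w) (K.mul_mem hp hw)
    refine ⟨w * t, K.mul_mem hw ht, fun x hx => ?_⟩
    have := eqOn_span (f := t * (p * w) * q) (g := q) htx x (hk hx)
    rw [hu k x (hk hx), h]
    exact congrArg w this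

end Limits

/-! ### Locally split submodules are summands -/

section LocallySplit

variable {A : Type u} [Ring A] {N : Type v} [AddCommGroup N] [Module A N]

/-- A submodule `P` of `N` is locally split if each finite subset of `P` is fixed pointwise by
an endomorphism of `N` with values in `P`. -/
def IsLocallySplit (P : Submodule A N) : Prop :=
  ∀ F : Finset N, (F : Set N) ⊆ P → ∃ r : Module.End A N, (∀ x, r x ∈ P) ∧ ∀ x ∈ F, r x = x

/-- The endomorphisms which are congruent to the identity modulo `P`. -/
def congruentOne (P : Submodule A N) : Submonoid (Module.End A N) where
  carrier := {q | ∀ x, x - q x ∈ P}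
  one_mem' x := by simp
  mul_mem' {a b} ha hb x := by
    have := P.add_mem (ha (b x)) (hb x)
    simpa using this

theorem apply_mem_of_mem_congruentOne {P : Submodule A N} {q : Module.End A N}
    (hq : q ∈ congruentOne P) {x : N} (hx : x ∈ P) : q x ∈ P :=
  (P.sub_mem_iff_right hx).1 (hq x)

theorem IsLocallySplit.exists_apply_eq_zero {P : Submodule A N} (h : IsLocallySplit P)
    (F : Finset N) (hF : (F : Set N) ⊆ P) : ∃ p ∈ congruentOne P, ∀ x ∈ F, p x = 0 := by
  obtain ⟨r, hr, hrF⟩ := h F hF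
  exact ⟨1 - r, fun x => by simpa using hr x, fun x hx => by simp [hrF x hx]⟩

theorem IsLocallySplit.exists_isMinimalOn_mul {P : Submodule A N} (h : IsLocallySplit P)
    (hS : HasStableOrbits A N) (F : Finset N) (q : Module.End A N) (hq : q ∈ congruentOne P) :
    ∃ p ∈ congruentOne P, IsMinimalOn (congruentOne P) F (p * q) := by
  classical
  obtain ⟨p, hp, hmin⟩ := hS.exists_forall_exists (congruentOne P) F q
  refine ⟨p, hp, fun p' hp' => ?_⟩
  set q₁ := p * q with hq₁
  have hq₁K : q₁ ∈ congruentOne P := mul_mem hp hq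
  obtain ⟨r, hr, hrF⟩ := h.exists_apply_eq_zero (F.image fun x => p' (q₁ (x - q₁ x))) (by
    intro z hz
    obtain ⟨x, -, rfl⟩ := Finset.mem_image.1 (Finset.mem_coe.1 hz)
    exact apply_mem_of_mem_congruentOne hp' (apply_mem_of_mem_congruentOne hq₁K (hq₁K x)))
  obtain ⟨t, ht⟩ := hmin (r * p') (mul_mem hr hp')
  have hq₂ : r * p' * q₁ ∈ congruentOne P := mul_mem (mul_mem hr hp') hq₁K
  -- Corrects `t` into the monoid: `1 - r * p' * q₁` has values in `P`. On `p' (q₁ x)` the result is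
  -- `r p' q₁ x + q₁ x - r p' q₁ q₁ x`, and `r` was chosen so that the outer terms cancel.
  refine ⟨(1 + (1 - r * p' * q₁) * t) * r, mul_mem (fun x => ?_) hr, fun x hx => ?_⟩
  · have := P.neg_mem (hq₂ (t x))
    simpa using this
  · have h1 : t (r (p' (q₁ x))) = q₁ x := ht x hx
    have h2 : r (p' (q₁ (x - q₁ x))) = 0 := hrF _ (Finset.mem_image_of_mem _ hx)
    simp only [map_sub, sub_eq_zero] at h2
    simp [h1, ← h2]

/-- A globally minimal `u` kills `P`: some `p` in the monoid kills `u z`, yet `p` can be undone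
there. Since `x - u x ∈ P`, `u` is idempotent with kernel `P`. -/
theorem IsLocallySplit.exists_isCompl {P : Submodule A N} (h : IsLocallySplit P)
    (hN : IsCountablyGenerated A N) (hS : HasStableOrbits A N) : ∃ Q, IsCompl P Q := by
  obtain ⟨u, hu, hmin⟩ := exists_isMinimalOn hN (congruentOne P)
    (fun u hu x => by
      obtain ⟨q, hq, hqx⟩ := hu {x}
      rw [hqx x (Finset.mem_singleton_self x)]
      exact hq x)
    (fun F q hq => h.exists_isMinimalOn_mul hS F q hq)
  have hzero : ∀ z ∈ P, u z = 0 := by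
    intro z hz
    obtain ⟨p, hp, hpz⟩ := h.exists_apply_eq_zero {u z} (by
      simpa using apply_mem_of_mem_congruentOne hu hz)
    obtain ⟨t, -, ht⟩ := hmin {z} p hp
    rw [← ht z (Finset.mem_singleton_self z), hpz _ (Finset.mem_singleton_self _), map_zero]
  have hP : P = LinearMap.ker u := by
    refine le_antisymm (fun z hz => hzero z hz) fun z hz => ?_
    have := hu z
    rwa [LinearMap.mem_ker.1 hz, sub_zero] at this
  refine ⟨LinearMap.range u, hP ▸ ⟨?_, ?_⟩⟩
  · rw [Submodule.disjoint_def]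
    rintro _ hx ⟨x, rfl⟩
    have := hzero _ (hu x)
    rw [map_sub, LinearMap.mem_ker.1 hx, sub_zero] at this
    exact this
  · rw [codisjoint_iff, eq_top_iff]
    intro x _
    rw [← sub_add_cancel x (u x)]
    exact Submodule.add_mem_sup (hP ▸ hu x) ⟨x, rfl⟩

theorem exists_isCompl_sSup_of_directedOn (hN : IsCountablyGenerated A N)
    (hS : HasStableOrbits A N) {c : Set (Submodule A N)} (hne : c.Nonempty)
    (hdir : DirectedOn (· ≤ ·) c) (hc : ∀ P ∈ c, ∃ Q, IsCompl P Q) :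
    ∃ Q, IsCompl (sSup c) Q := by
  classical
  refine IsLocallySplit.exists_isCompl (fun F hF => ?_) hN hS
  have key : ∃ P ∈ c, (F : Set N) ⊆ P := by
    induction F using Finset.induction_on with
    | empty => exact ⟨hne.some, hne.some_mem, by simp⟩
    | insert a F ha ih =>
      rw [Finset.coe_insert, Set.insert_subset_iff] at hF
      obtain ⟨P, hP, hFP⟩ := ih hF.2
      obtain ⟨P', hP', haP'⟩ := (Submodule.mem_sSup_of_directed hne hdir).1 hF.1
      obtain ⟨P'', hP'', h1, h2⟩ := hdir P hP P' hP'
      refine ⟨P'', hP'', ?_⟩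
      rw [Finset.coe_insert, Set.insert_subset_iff]
      exact ⟨h2 haP', hFP.trans h1⟩
  obtain ⟨P, hP, hFP⟩ := key
  obtain ⟨Q, hPQ⟩ := hc P hP
  refine ⟨P.subtype ∘ₗ Submodule.projectionOnto P Q hPQ, fun x => ?_, fun x hx => ?_⟩
  · exact le_sSup hP (Submodule.projectionOnto P Q hPQ x).2
  · exact congrArg Subtype.val
      (Submodule.projectionOnto_apply_left hPQ ⟨x, hFP hx⟩)

end LocallySplit

/-! ### Indecomposable summands and their endomorphism rings -/

section Indecomposable

variable {A : Type u} [Ring A] {N : Type v} [AddCommGroup N] [Module A N]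

variable (A N) in
/-- A module is indecomposable if it is nonzero and has no nontrivial direct sum decomposition. -/
def IsIndecomposable : Prop :=
  Nontrivial N ∧ ∀ P Q : Submodule A N, IsCompl P Q → P = ⊥ ∨ Q = ⊥

/-- If `R` is complementary to `P` and decomposes as `D ⊔ E` then `P ⊔ D` and `E` are
complementary. -/
theorem isCompl_sup_left_of_isCompl {P R D E : Submodule A N} (h : IsCompl P R)
    (hdis : Disjoint D E) (hsup : D ⊔ E = R) : IsCompl (P ⊔ D) E := by
  refine ⟨?_, ?_⟩
  · have : Disjoint (D ⊔ E) P := hsup ▸ h.disjoint.symm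
    rw [sup_comm] at this ⊢
    exact (hdis.symm.disjoint_sup_right_of_disjoint_sup_left
      (by rwa [sup_comm] at this ⊢)).symm
  · rw [codisjoint_iff, sup_assoc, hsup, h.sup_eq_top]

/-- Take a summand `P` maximal among those avoiding `y`. A splitting of its complement into nonzero
`D₁`, `D₂` would put `y` in `(P ⊔ D₁) ⊓ (P ⊔ D₂) = P`. -/
theorem exists_isCompl_isIndecomposable [Nontrivial N] (hN : IsCountablyGenerated A N)
    (hS : HasStableOrbits A N) : ∃ P D : Submodule A N, IsCompl P D ∧ IsIndecomposable A D := by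
  obtain ⟨y, hy⟩ := exists_ne (0 : N)
  obtain ⟨P, -, ⟨⟨D, hPD⟩, hyP⟩, hmax⟩ := zorn_le_nonempty₀
    {P : Submodule A N | (∃ Q, IsCompl P Q) ∧ y ∉ P} (fun c hc hchain Q hQ =>
      ⟨sSup c, ⟨exists_isCompl_sSup_of_directedOn hN hS ⟨Q, hQ⟩ hchain.directedOn
        fun P hP => (hc hP).1, fun hy => by
          obtain ⟨P, hP, hyP⟩ := (Submodule.mem_sSup_of_directed ⟨Q, hQ⟩ hchain.directedOn).1 hy
          exact (hc hP).2 hyP⟩, fun P hP => le_sSup hP⟩) ⊥ ⟨⟨⊤, isCompl_bot_top⟩, by simpa using hy⟩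
  have key : ∀ D₁ D₂ : Submodule A N, Disjoint D₁ D₂ → D₁ ⊔ D₂ = D → D₁ ≠ ⊥ → y ∈ P ⊔ D₁ := by
    intro D₁ D₂ hdis hsup hne
    by_contra hy
    have hle := hmax ⟨⟨D₂, isCompl_sup_left_of_isCompl hPD hdis hsup⟩, hy⟩ le_sup_left
    have hD₁ : D₁ ≤ D := hsup ▸ le_sup_left
    exact hne (le_bot_iff.1 (hPD.disjoint (le_sup_right.trans hle) hD₁))
  refine ⟨P, D, hPD, ?_, fun P' Q' h => ?_⟩
  · rw [Submodule.nontrivial_iff_ne_bot]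
    rintro rfl
    exact hyP (by rw [eq_top_of_isCompl_bot hPD]; trivial)
  · by_contra! hne
    have hinj := Submodule.map_injective_of_injective D.injective_subtype
    have hdis : Disjoint (P'.map D.subtype) (Q'.map D.subtype) :=
      Submodule.disjoint_map D.injective_subtype h.disjoint
    have hsup : P'.map D.subtype ⊔ Q'.map D.subtype = D := by
      rw [← Submodule.map_sup, h.sup_eq_top, Submodule.map_subtype_top]
    have h1 := key _ _ hdis hsup (fun h0 => hne.1 (hinj (by rw [h0, Submodule.map_bot])))
    have h2 := key _ _ hdis.symm ((sup_comm _ _).trans hsup)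
      (fun h0 => hne.2 (hinj (by rw [h0, Submodule.map_bot])))
    obtain ⟨p₁, hp₁, d₁, hd₁, e₁⟩ := Submodule.mem_sup.1 h1
    obtain ⟨p₂, hp₂, d₂, hd₂, e₂⟩ := Submodule.mem_sup.1 h2
    have hd : d₁ - d₂ = p₂ - p₁ := by
      rw [sub_eq_sub_iff_add_eq_add, add_comm, e₁, e₂]
    have hd₁D : d₁ ∈ D := hsup ▸ Submodule.mem_sup_left hd₁
    have hd₂D : d₂ ∈ D := hsup ▸ Submodule.mem_sup_right hd₂
    have h0 : d₁ - d₂ = 0 := Submodule.disjoint_def.1 hPD.disjoint _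
      (hd ▸ P.sub_mem hp₂ hp₁) (D.sub_mem hd₁D hd₂D)
    rw [sub_eq_zero] at h0
    have : d₁ = 0 := Submodule.disjoint_def.1 hdis _ hd₁ (h0 ▸ hd₂)
    rw [this, add_zero] at e₁
    exact hyP (e₁ ▸ hp₁)

/-- Local left inverses make `f` injective with locally split range; that range is then a nonzero
summand. -/
theorem IsIndecomposable.bijective_of_locally_leftInverse (h : IsIndecomposable A N)
    (hN : IsCountablyGenerated A N) (hS : HasStableOrbits A N) {f : Module.End A N}
    (hf : ∀ F : Finset N, ∃ t : Module.End A N, ∀ x ∈ F, t (f x) = x) :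
    Function.Bijective f := by
  classical
  have := h.1
  have hinj : Function.Injective f := by
    rw [injective_iff_map_eq_zero]
    intro x hx
    obtain ⟨t, ht⟩ := hf {x}
    rw [← ht x (Finset.mem_singleton_self x), hx, map_zero]
  have hsplit : IsLocallySplit (LinearMap.range f) := by
    intro F hF
    choose! g hg using fun x (hx : x ∈ (F : Set N)) => hF hx
    obtain ⟨t, ht⟩ := hf (F.image g)
    refine ⟨f * t, fun x => ⟨t x, rfl⟩, fun x hx => ?_⟩
    have := congrArg f (ht _ (Finset.mem_image_of_mem g hx))
    rwa [hg x hx] at this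
  obtain ⟨Q, hQ⟩ := hsplit.exists_isCompl hN hS
  refine ⟨hinj, LinearMap.range_eq_top.1 ?_⟩
  rcases h.2 _ _ hQ with h0 | rfl
  · obtain ⟨x, hx⟩ := exists_ne (0 : N)
    exact absurd (hinj ((LinearMap.congr_fun (LinearMap.range_eq_bot.1 h0) x).trans
      (map_zero f).symm)) hx
  · exact eq_top_of_isCompl_bot hQ

/-- Fitting decomposition: if `u * (1 - u)` is pointwise nilpotent on an indecomposable module and
`1 - u` is not injective, then `u` is bijective. -/
theorem IsIndecomposable.bijective_of_pointwise_nilpotent (h : IsIndecomposable A N)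
    {u : Module.End A N} (hu : ∀ x : N, ∃ n : ℕ, (u ^ n * (1 - u) ^ n : Module.End A N) x = 0) {y : N} (hy : y ≠ 0)
    (huy : u y = y) : Function.Bijective u := by
  have hcop : ∀ m n : ℕ, ∃ a b : Module.End A N, Commute a u ∧ Commute b u ∧
      a * u ^ m + b * (1 - u) ^ n = 1 := by
    intro m n
    have : IsCoprime (Polynomial.X : Polynomial ℤ) (1 - Polynomial.X) := ⟨1, 1, by ring⟩
    obtain ⟨a, b, hab⟩ := this.pow (m := m) (n := n)
    refine ⟨Polynomial.aeval u a, Polynomial.aeval u b, ?_, ?_, ?_⟩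
    · simpa using (Commute.all a Polynomial.X).map (Polynomial.aeval u)
    · simpa using (Commute.all b Polynomial.X).map (Polynomial.aeval u)
    · simpa using congrArg (Polynomial.aeval u) hab
  have hv : Commute (1 - u) u := (Commute.one_left u).sub_left (Commute.refl u)
  have hmono : ∀ w : Module.End A N, Monotone fun n => LinearMap.ker (w ^ n) := by
    intro w m n hmn x hx
    rw [LinearMap.mem_ker] at hx ⊢
    rw [← Nat.sub_add_cancel hmn, pow_add, Module.End.mul_apply, hx, map_zero]
  have hmem : ∀ (w : Module.End A N) x, x ∈ ⨆ n, LinearMap.ker (w ^ n) ↔ ∃ n, (w ^ n) x = 0 :=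
    fun w x => by simp [Submodule.mem_iSup_of_directed _ (hmono w).directed_le]
  have hcompl : IsCompl (⨆ n, LinearMap.ker (u ^ n)) (⨆ n, LinearMap.ker ((1 - u) ^ n)) := by
    refine ⟨?_, ?_⟩
    · rw [Submodule.disjoint_def]
      intro x hx hx'
      obtain ⟨m, hm⟩ := (hmem _ _).1 hx
      obtain ⟨n, hn⟩ := (hmem _ _).1 hx'
      obtain ⟨a, b, -, -, hab⟩ := hcop m n
      have := LinearMap.congr_fun hab x
      simpa [hm, hn, eq_comm] using this
    · rw [codisjoint_iff, eq_top_iff]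
      intro x _
      obtain ⟨n, hn⟩ := hu x
      obtain ⟨a, b, ha, hb, hab⟩ := hcop n n
      have hx : (b * (1 - u) ^ n) x + (a * u ^ n) x = x := by
        rw [add_comm]; exact LinearMap.congr_fun hab x
      rw [← hx]
      refine Submodule.add_mem_sup ((hmem _ _).2 ⟨n, ?_⟩) ((hmem _ _).2 ⟨n, ?_⟩)
      · rw [← Module.End.mul_apply, ← mul_assoc, ← (hb.pow_right n).eq, mul_assoc,
          Module.End.mul_apply, hn, map_zero]
      · have ha' : Commute a (1 - u) := (Commute.one_right a).sub_right ha
        rw [← Module.End.mul_apply, ← mul_assoc, ← (ha'.pow_right n).eq, mul_assoc,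
          (hv.pow_pow n n).eq, Module.End.mul_apply, hn, map_zero]
  rcases h.2 _ _ hcompl with h0 | h1
  · rw [h0] at hcompl
    have htop := eq_top_of_bot_isCompl hcompl
    refine ⟨?_, fun x => ?_⟩
    · rw [← LinearMap.ker_eq_bot, eq_bot_iff, ← h0]
      intro x hx
      exact (hmem _ _).2 ⟨1, by simpa using hx⟩
    · obtain ⟨n, hn⟩ := (hmem (1 - u) x).1 (htop ▸ Submodule.mem_top)
      obtain ⟨a, b, ha, -, hab⟩ := hcop 1 n
      refine ⟨a x, ?_⟩
      have := LinearMap.congr_fun hab x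
      rw [pow_one, ha.eq] at this
      simpa [hn] using this
  · exact absurd ((Submodule.mem_bot A).1 (h1 ▸ (hmem _ _).2 ⟨1, by simp [huy]⟩)) hy

/-- The endomorphisms fixing the vector `y`. -/
def fixing (A : Type u) [Ring A] {N : Type v} [AddCommGroup N] [Module A N] (y : N) :
    Submonoid (Module.End A N) where
  carrier := {u | u y = y}
  one_mem' := rfl
  mul_mem' {a b} (ha : a y = y) (hb : b y = y) := (congrArg a hb).trans ha

theorem mem_fixing {y : N} {u : Module.End A N} : u ∈ fixing A y ↔ u y = y := Iff.rfl

theorem exists_isMinimalOn_fixing (hN : IsCountablyGenerated A N) (hS : HasStableOrbits A N)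
    (y : N) : ∃ u ∈ fixing A y, ∀ F, IsMinimalOn (fixing A y) F u := by
  classical
  refine exists_isMinimalOn hN _ (fun u hu => ?_) (fun F q hq => ?_)
  · obtain ⟨q, hq, h⟩ := hu {y}
    rw [mem_fixing, h y (Finset.mem_singleton_self y), hq]
  -- Including `y` in the finite set forces the inverse `t` to fix `y`.
  · obtain ⟨p, hp, h⟩ := hS.exists_forall_exists (fixing A y) (insert y F) q
    refine ⟨p, hp, fun p' hp' => ?_⟩
    obtain ⟨t, ht⟩ := h p' hp'
    refine ⟨t, ?_, fun x hx => ht x (Finset.mem_insert_of_mem hx)⟩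
    have := ht y (Finset.mem_insert_self y F)
    rwa [Module.End.mul_apply, hq, hp, hp'] at this

/-- The nonunits turn out to be exactly the maps killing a vector `y` of minimal orbit, so two of
them cannot sum to 1. The work is to show that a minimal `u` fixing `y` is bijective. -/
theorem IsIndecomposable.isLocalRing_end (h : IsIndecomposable A N)
    (hN : IsCountablyGenerated A N) (hS : HasStableOrbits A N) :
    IsLocalRing (Module.End A N) := by
  classical
  have := h.1
  obtain ⟨y, hy, hsimple⟩ := hS.exists_minimal_orbit
  obtain ⟨u, hu, hmin⟩ := exists_isMinimalOn_fixing hN hS y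
  have hrad : ∀ s : Module.End A N, s y = 0 → Function.Bijective (1 - s * u : Module.End A N) := by
    intro s hs
    refine h.bijective_of_locally_leftInverse hN hS fun F => ?_
    obtain ⟨t, -, ht⟩ := hmin F (1 - u * s) (by simp [mem_fixing, hs])
    -- The usual passage from an inverse of `1 - u * s` to one of `1 - s * u`; here `t` undoes `1 -
    -- u * s` only on `u x`.
    refine ⟨1 + s * t * u, fun x hx => ?_⟩
    have := congrArg s (ht x hx)
    simp only [LinearMap.sub_apply, Module.End.one_apply, Module.End.mul_apply, map_sub,
      LinearMap.add_apply] at this ⊢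
    rw [sub_eq_iff_eq_add] at this
    rw [this]
    abel
  have hnil : ∀ x : N, ∃ n : ℕ, (u ^ n * (1 - u) ^ n : Module.End A N) x = 0 := by
    intro x
    have hv : Commute (1 - u) u := (Commute.one_left u).sub_left (Commute.refl u)
    obtain ⟨n, t, ht⟩ := hS {x} fun _ => (1 - u) * u
    have hpow := partialComp_const ((1 - u) * u) n
    refine ⟨n, ?_⟩
    rw [← (hv.pow_pow n n).eq, ← hv.mul_pow, ← hpow]
    have huy : u y = y := hu
    -- Stability makes `((1 - u) * u) ^ n` of `x` a fixed vector of `t * (1 - u) * u`; since `1 - u`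
    -- kills `y`, `hrad` makes it zero.
    apply (hrad (t * (1 - u)) (by simp [huy])).injective
    rw [map_zero, LinearMap.sub_apply, sub_eq_zero]
    exact (ht x (Finset.mem_singleton_self x)).symm
  have hbij := h.bijective_of_pointwise_nilpotent hnil hy hu
  have hunit : ∀ s : Module.End A N, s y ≠ 0 → IsUnit s := by
    intro s hs
    obtain ⟨t, ht⟩ := hsimple s hs
    have hts : Function.Bijective (t * s : Module.End A N) := by
      refine h.bijective_of_locally_leftInverse hN hS fun F => ?_
      choose g hg using hbij.surjective
      obtain ⟨t', -, ht'⟩ := hmin (F.image g) (t * s) ht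
      refine ⟨t', fun x hx => ?_⟩
      have := ht' _ (Finset.mem_image_of_mem g hx)
      rwa [hg] at this
    obtain ⟨r, hr⟩ := (Module.End.isUnit_iff _).2 hts
    rw [Module.End.isUnit_iff]
    refine h.bijective_of_locally_leftInverse hN hS fun F => ⟨↑r⁻¹ * t, fun x _ => ?_⟩
    have := LinearMap.congr_fun r.inv_mul x
    rwa [hr] at this
  refine ⟨fun {a b} hab => ?_⟩
  by_cases ha : a y = 0
  · refine Or.inr (hunit b fun hb => hy ?_)
    have := LinearMap.congr_fun hab y
    simpa [ha, hb, eq_comm] using this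
  · exact Or.inl (hunit a ha)

end Indecomposable

/-! ### Splitting into summands with local endomorphism rings; T-nilpotence -/

section Decomposition

variable {A : Type u} [Ring A] {M : Type v} [AddCommGroup M] [Module A M]

theorem isLocalRing_end_congr {N N' : Type v} [AddCommGroup N] [Module A N] [AddCommGroup N']
    [Module A N'] (e : N ≃ₗ[A] N') [IsLocalRing (Module.End A N)] :
    IsLocalRing (Module.End A N') :=
  RingHom.domain_isLocalRing (e.symm.conjRingEquiv : Module.End A N' →+* Module.End A N)

theorem exists_isCompl_isLocalRing_end [Nontrivial M] (hM : IsCountablyGenerated A M)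
    (hS : HasStableOrbits A M) :
    ∃ P D : Submodule A M, IsCompl P D ∧ IsLocalRing (Module.End A D) := by
  obtain ⟨P, D, hPD, hD⟩ := exists_isCompl_isIndecomposable hM hS
  have hπ := Submodule.projectionOnto_apply_left hPD.symm
  refine ⟨P, D, hPD, hD.isLocalRing_end
    (hM.of_surjective (D.projectionOnto P hPD.symm) fun x => ⟨x, hπ x⟩)
    (hS.of_retract D.subtype (D.projectionOnto P hPD.symm) hπ)⟩

theorem sSupIndep_insert {s : Set (Submodule A M)} (hs : sSupIndep s) {D : Submodule A M}
    (hD : Disjoint (sSup s) D) : sSupIndep (insert D s) := by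
  intro z hz
  rcases eq_or_ne z D with rfl | hne
  · exact hD.symm.mono_right (sSup_le_sSup (by simp))
  · have hzs : z ∈ s := (Set.mem_insert_iff.1 hz).resolve_left hne
    have hle : sSup (insert D s \ {z}) ≤ sSup (s \ {z}) ⊔ D := by
      refine sSup_le fun w hw => ?_
      rcases hw.1 with rfl | hws
      · exact le_sup_right
      · exact le_sup_of_le_left (le_sSup ⟨hws, hw.2⟩)
    exact ((hs hzs).disjoint_sup_right_of_disjoint_sup_left
      (hD.mono_left (sup_le (le_sSup hzs) (sSup_le_sSup Set.sdiff_subset)))).mono_right hle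

theorem exists_sSupIndep_isLocalRing_end (hM : IsCountablyGenerated A M)
    (hS : HasStableOrbits A M) :
    ∃ s : Set (Submodule A M), sSupIndep s ∧ sSup s = ⊤ ∧
      ∀ D ∈ s, IsLocalRing (Module.End A D) := by
  obtain ⟨s, -, ⟨hind, hloc, R, hR⟩, hmax⟩ := zorn_subset_nonempty
    {s : Set (Submodule A M) | sSupIndep s ∧ (∀ D ∈ s, IsLocalRing (Module.End A D)) ∧
      ∃ Q, IsCompl (sSup s) Q} (fun c hc hchain hne =>
      ⟨⋃₀ c, ⟨iSupIndep_sUnion_of_directed hchain.directedOn fun t ht => (hc ht).1,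
        fun D hD => by
          obtain ⟨t, ht, hDt⟩ := hD
          exact (hc ht).2.1 D hDt, by
        rw [sSup_sUnion, ← sSup_image]
        refine exists_isCompl_sSup_of_directedOn hM hS (hne.image _) ?_ ?_
        · rintro _ ⟨t, ht, rfl⟩ _ ⟨t', ht', rfl⟩
          obtain ⟨t'', ht'', h, h'⟩ := hchain.directedOn t ht t' ht'
          exact ⟨_, ⟨t'', ht'', rfl⟩, sSup_le_sSup h, sSup_le_sSup h'⟩
        · rintro _ ⟨t, ht, rfl⟩
          exact (hc ht).2.2⟩, fun t ht => Set.subset_sUnion_of_mem ht⟩)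
    ∅ ⟨sSupIndep_empty, by simp, ⊤, by simpa using isCompl_bot_top⟩
  refine ⟨s, hind, ?_, hloc⟩
  rcases eq_or_ne R ⊥ with rfl | hne
  · exact eq_top_of_isCompl_bot hR
  exfalso
  have : Nontrivial R := (Submodule.nontrivial_iff_ne_bot).2 hne
  have hπ := Submodule.projectionOnto_apply_left hR.symm
  obtain ⟨P, D, hPD, hD⟩ := exists_isCompl_isLocalRing_end
    (hM.of_surjective (R.projectionOnto _ hR.symm) fun x => ⟨x, hπ x⟩)
    (hS.of_retract R.subtype (R.projectionOnto _ hR.symm) hπ)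
  have hDR : D.map R.subtype ≤ R := Submodule.map_subtype_le R D
  have hdis : Disjoint (sSup s) (D.map R.subtype) := hR.disjoint.mono_right hDR
  have hloc' : IsLocalRing (Module.End A (D.map R.subtype)) :=
    isLocalRing_end_congr (R.equivSubtypeMap D)
  have hle := hmax (y := insert (D.map R.subtype) s)
    ⟨sSupIndep_insert hind hdis, by simpa using ⟨hloc', hloc⟩, P.map R.subtype, by
      rw [sSup_insert, sup_comm]
      refine isCompl_sup_left_of_isCompl hR
        (Submodule.disjoint_map R.injective_subtype hPD.disjoint.symm) ?_
      rw [← Submodule.map_sup, sup_comm, hPD.sup_eq_top, Submodule.map_subtype_top]⟩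
    (Set.subset_insert _ _)
  have hbot : D.map R.subtype = ⊥ :=
    disjoint_self.1 (hdis.mono_left (le_sSup (hle (Set.mem_insert _ _))))
  have : Nontrivial (Module.End A (D.map R.subtype)) := hloc'.toNontrivial
  rw [hbot] at this
  exact not_subsingleton (Module.End A (⊥ : Submodule A M)) inferInstance

theorem nontrivial_of_isLocalRing_end (N : Type v) [AddCommGroup N] [Module A N]
    [IsLocalRing (Module.End A N)] : Nontrivial N := by
  by_contra h
  rw [not_nontrivial_iff_subsingleton] at h
  exact not_subsingleton (Module.End A N) inferInstance

/-- A map out of a nonzero module into a module with local endomorphism ring is bijective if it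
becomes bijective after composition with some map in the other direction. -/
theorem bijective_of_bijective_comp {N N' : Type v} [AddCommGroup N] [Module A N] [Nontrivial N]
    [AddCommGroup N'] [Module A N'] [IsLocalRing (Module.End A N')] {f : N →ₗ[A] N'}
    {t : N' →ₗ[A] N} (h : Function.Bijective (t ∘ₗ f)) : Function.Bijective f := by
  let e := LinearEquiv.ofBijective (t ∘ₗ f) h
  let t' : N' →ₗ[A] N := e.symm.toLinearMap ∘ₗ t
  have ht' : ∀ x, t' (f x) = x := fun x => e.symm_apply_apply x
  have hinj : Function.Injective f := Function.LeftInverse.injective ht'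
  refine ⟨hinj, ?_⟩
  -- `f ∘ₗ t'` is idempotent; the complementary idempotent kills the image of `f`, so it cannot be a
  -- unit.
  rcases IsLocalRing.isUnit_or_isUnit_of_add_one
    (show (f ∘ₗ t' : Module.End A N') + (1 - f ∘ₗ t') = 1 by abel) with h1 | h1
  · intro x
    obtain ⟨z, hz⟩ := ((Module.End.isUnit_iff _).1 h1).surjective x
    exact ⟨t' z, hz⟩
  · obtain ⟨x, hx⟩ := exists_ne (0 : N)
    have : f x = 0 := ((Module.End.isUnit_iff _).1 h1).injective (by simp [ht'])
    exact absurd (hinj (this.trans (map_zero f).symm)) hx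

theorem isSummableFamily_of_eventually_eq_zero {N : ℕ → Type v} [∀ i, AddCommGroup (N i)]
    [∀ i, Module A (N i)] (f : ∀ i, M →ₗ[A] N i) (h : ∀ x, ∃ n, ∀ m, n ≤ m → f m x = 0) :
    IsSummableFamily f := by
  choose n hn using h
  let g : M → ⨁ i, N i := fun x => DirectSum.mk N (Finset.range (n x)) (fun i => f i x)
  have hg : ∀ x i, g x i = f i x := by
    intro x i
    by_cases hi : i ∈ Finset.range (n x)
    · exact DirectSum.mk_apply_of_mem hi
    · rw [hn x i (by simpa using hi)]
      exact DirectSum.mk_apply_of_notMem hi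
  refine ⟨{ toFun := g, map_add' := fun x y => ?_, map_smul' := fun a x => ?_ },
    fun i x => hg x i⟩
  · ext i
    rw [DirectSum.add_apply, hg, hg, hg, map_add]
  · ext i
    rw [RingHom.id_apply, DirectSum.smul_apply, hg, hg, map_smul]

/-- Extended to `M`, the maps have a step reversible at the current image `c n` of `x`, so some `t'
∘ₗ f n` fixes `c n`. It is not a unit because `f n` is not bijective, so by locality `1 - t' ∘ₗ f n`
is one, and it kills `c n`. -/
theorem isLocallyTNilpotent_of_isLocalRing_end (hS : HasStableOrbits A M) {Z : Type w}
    (N : Z → Submodule A M) (hN : ∀ z, ∃ Q, IsCompl (N z) Q)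
    (hloc : ∀ z, IsLocalRing (Module.End A (N z))) : IsLocallyTNilpotent A fun z => N z := by
  have hnt : ∀ z, Nontrivial (N z) := fun z =>
    nontrivial_of_isLocalRing_end (A := A) (N z)
  refine ⟨hnt, fun z f hf => isSummableFamily_of_eventually_eq_zero _ fun x => ?_⟩
  choose Q hQ using hN
  let π : ∀ z, M →ₗ[A] N z := fun z => (N z).projectionOnto (Q z) (hQ z)
  have hπ : ∀ z (x : N z), π z x = x := fun z => Submodule.projectionOnto_apply_left (hQ z)
  let s : ℕ → Module.End A M := fun i => (N (z (i + 1))).subtype ∘ₗ f i ∘ₗ π (z i)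
  let c : ∀ n, N (z n) := fun n => Nat.rec x (fun n y => f n y) n
  have hc : ∀ n, partialComp s n x = (c n).1 := by
    intro n
    induction n with
    | zero => rfl
    | succ n ih => simp [partialComp, ih, s, hπ, c]
  have hseq : ∀ n, seqComp (N := fun n => N (z n)) f n x = c (n + 1) := by
    intro n
    induction n with
    | zero => rfl
    | succ n ih => rw [seqComp, LinearMap.comp_apply, ih]
  obtain ⟨n, t, ht⟩ := hS {(x : M)} s
  have ht := ht _ (Finset.mem_singleton_self _)
  rw [hc, show s n (c n).1 = (f n (c n)).1 by simp [s, hπ]] at ht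
  let t' : N (z (n + 1)) →ₗ[A] N (z n) := π (z n) ∘ₗ t ∘ₗ (N (z (n + 1))).subtype
  have ht' : t' (f n (c n)) = c n := by
    simp only [t', LinearMap.comp_apply, Submodule.subtype_apply, ht, hπ]
  have hcn : c n = 0 := by
    rcases IsLocalRing.isUnit_or_isUnit_of_add_one
      (show (t' ∘ₗ f n : Module.End A (N (z n))) + (1 - t' ∘ₗ f n) = 1 by abel) with h1 | h1
    · exact absurd (bijective_of_bijective_comp ((Module.End.isUnit_iff _).1 h1)) (hf n)
    · exact ((Module.End.isUnit_iff _).1 h1).injective (by simp [ht'])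
  refine ⟨n, fun m hm => ?_⟩
  rw [hseq]
  have hzero : ∀ m, n ≤ m → c m = 0 := by
    intro m hm
    induction m, hm using Nat.le_induction with
    | base => exact hcn
    | succ m hm ih => exact (congrArg (f m) ih).trans (map_zero _)
  exact hzero _ (hm.trans m.le_succ)

end Decomposition

end PerfectDecomp

theorem mainTheorem9 {A : Type u} [Ring A] {M : Type v} [AddCommGroup M] [Module A M]
    (hM : PerfectDecomp.IsCountablyGenerated A M)
    (hcoperf : PerfectDecomp.IsEndoSigmaCoperfect A M) :
    PerfectDecomp.HasPerfectDecomposition A M := by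
  classical
  have hS := hcoperf.hasStableOrbits
  obtain ⟨s, hind, htop, hloc⟩ := PerfectDecomp.exists_sSupIndep_isLocalRing_end hM hS
  have hint : DirectSum.IsInternal fun D : s => (D : Submodule A M) :=
    DirectSum.isInternal_submodule_of_iSupIndep_of_iSup_eq_top ((sSupIndep_iff s).1 hind)
      (by rw [← sSup_eq_iSup', htop])
  refine ⟨s, fun D => (D : Submodule A M), inferInstance, inferInstance,
    PerfectDecomp.isLocallyTNilpotent_of_isLocalRing_end hS _ (fun D => ?_)
      (fun D => hloc D D.2), ⟨(LinearEquiv.ofBijective (DirectSum.coeLinearMap _) hint).symm⟩⟩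
  refine ⟨sSup (s \ {(D : Submodule A M)}), hind D.2, ?_⟩
  rw [codisjoint_iff, ← sSup_insert, Set.insert_sdiff_singleton, Set.insert_eq_of_mem D.2, htop]
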